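/- Let $G$ be a finite simple triangulated planar graph, i.e. $G$ has a planar embedding in which every face (including the outer face) is bounded by a simple cycle of length 3. Then $\mathrm{sGMh}(G)\le \mathrm{sHh}(G)$. Moreover, for every simple homotopy of $G$ (for any choice of the outer face) of height $k$ there is a simple grid-major representation of $G$ of height $k$ in which any two grid-points at distance one carry equal or adjacent labels; equivalently, replacing grid-points by unit squares, $G$ has a contact representation of height $k$ by $x$-monotone orthogonal polygons. Here the notions are as follows. *Grid-major representations.* The $W\times H$-grid has vertex set $\{1,\dots,W\}\times\{1,\dots,H\}$, with edges between points at distance one; its height is $H$. A grid-major representation of $G$ labels each grid-point with a vertex of $G$ such that (1) every vertex of $G$ occurs as a label, (2) for every vertex $a$ the points labelled $a$ induce a connected subgraph of the grid, and (3) for every edge $ab$ of $G$ some grid-edge has ends labelled $a$ and $b$. It is simple if in every column and for every vertex $a$ the points of that column labelled $a$ induce a connected (possibly empty) subgraph. $\mathrm{sGMh}(G)$ is the minimum height of a simple grid-major representation of $G$. *Simple homotopies.* Fix a face $f$ of the triangulated embedding as outer face; the other faces are inner. A simple homotopy is a sequence $h_0,\dots,h_W$ of walks in $G$ such that: 1.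 $h_0$ and $h_W$ are trivial walks at two distinct vertices $u$ and $v$ of $f$. 2. Let $s$ and $t$ be the two paths from $u$ to $v$ along the boundary of $f$ (named in either order). Every $h_i$ starts at a vertex of $s$ and ends at a vertex of $t$. 3. For $0\le i<W$, $h_{i+1}$ arises from $h_i$ by one of the following moves: - face-flip: for an inner face $\{x,y,z\}$, replace a subpath $x$-$y$ by $x$-$z$-$y$, or conversely; - edge-slide: for an edge $xy$ incident to two inner faces $\{x,y,a\}$ and $\{x,y,b\}$, replace a subpath $a$-$x$-$b$ by $a$-$y$-$b$; - boundary-move: for an edge $xy$ of $s$ where $x$ is the start of $h_i$, prepend $y$, or conversely remove the starting vertex $y$ from a walk starting with $y$-$x$; symmetrically for edges of $t$ at the end of the walk; - boundary-edge-slide: for an edge $xy$ of $s$ incident to an inner face $\{x,y,z\}$ where $h_i$ starts with $x$-$z$, replace this start by $y$-$z$; symmetrically for edges of $t$ at the end of the walk. 4. Every $h_i$ is a simple path, and if a vertex belongs to $h_i$ and $h_j$ with $i<j$, then it belongs to all $h_l$ with $i\le l\le j$. The height of a simple homotopy is the maximum number of vertices on a walk $h_i$. $\mathrm{sHh}(G)$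 is the minimum height of a simple homotopy of $G$ over all choices of the outer face. (A minimum over the empty set is read as $\infty$.) -/

import Mathlib

/-- A rotation system of `G`: a permutation of the darts (directed edges) of `G` that fixes the
tail of each dart and permutes the darts leaving each vertex in a single cycle (the cyclic order
of the edges around the vertex). -/
structure RotationSystem {V : Type*} (G : SimpleGraph V) where
  rot : Equiv.Perm G.Dart
  rot_fst : ∀ d, (rot d).fst = d.fst
  sameCycle_of_fst_eq : ∀ d e : G.Dart, d.fst = e.fst → rot.SameCycle d e

namespace RotationSystem

variable {V : Type*} {G : SimpleGraph V}

/-- The permutation that follows the face boundaries: the dart `a → b` is followed by the dart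
that comes after `b → a` in the rotation at `b`. -/
def facePerm (M : RotationSystem G) : Equiv.Perm G.Dart :=
  (SimpleGraph.Dart.symm_involutive.toPerm SimpleGraph.Dart.symm).trans M.rot

/-- The faces of the embedding: the cycles of `facePerm`. -/
def Face (M : RotationSystem G) : Type _ :=
  Quotient (Equiv.Perm.SameCycle.setoid M.facePerm)

/-- The face on a given side of an edge. -/
def faceOf (M : RotationSystem G) (d : G.Dart) : M.Face :=
  Quotient.mk (Equiv.Perm.SameCycle.setoid M.facePerm) d

/-- The vertices on the boundary of a face. -/
def faceVerts (M : RotationSystem G) (F : M.Face) : Set V :=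
  {a | ∃ d : G.Dart, M.faceOf d = F ∧ d.fst = a}

/-- A rotation system of a connected graph (with at least one edge) describes an embedding in the
sphere if it satisfies Euler's formula. -/
def IsPlanar (M : RotationSystem G) : Prop :=
  G.Connected ∧ (Nat.card V : ℤ) - Nat.card G.edgeSet + Nat.card M.Face = 2

/-- A triangulation: a planar embedding in which every face is bounded by exactly three
directed edges. Since `G` has neither loops nor multiple edges, these form a simple cycle. -/
def IsTriangulation (M : RotationSystem G) : Prop :=
  M.IsPlanar ∧ ∀ F : M.Face, {d : G.Dart | M.faceOf d = F}.ncard = 3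

end RotationSystem

/-- `xy` is one of the edges of the path `p`, given by its list of vertices. -/
def IsEdgeOfPath {V : Type*} (p : List V) (x y : V) : Prop :=
  [x, y] <:+: p ∨ [y, x] <:+: p

/-- The moves of a discrete simple homotopy with outer face `F`, whose two boundary paths are
`s` (for the starts of the curves) and `t` (for their ends). Curves are lists of vertices; a face
is inner if it differs from `F`. -/
inductive HomotopyMove {V : Type*} {G : SimpleGraph V} (M : RotationSystem G) (F : M.Face)
    (s t : List V) : List V → List V → Prop
  | faceFlip (F₁ : M.Face) (x y z : V) (A B : List V) :
      F₁ ≠ F → M.faceVerts F₁ = {x, y, z} →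
      HomotopyMove M F s t (A ++ [x, y] ++ B) (A ++ [x, z, y] ++ B)
  | faceFlipReverse (F₁ : M.Face) (x y z : V) (A B : List V) :
      F₁ ≠ F → M.faceVerts F₁ = {x, y, z} →
      HomotopyMove M F s t (A ++ [x, z, y] ++ B) (A ++ [x, y] ++ B)
  | edgeSlide (F₁ F₂ : M.Face) (x y a b : V) (A B : List V) :
      F₁ ≠ F → F₂ ≠ F → F₁ ≠ F₂ →
      M.faceVerts F₁ = {x, y, a} → M.faceVerts F₂ = {x, y, b} →
      HomotopyMove M F s t (A ++ [a, x, b] ++ B) (A ++ [a, y, b] ++ B)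
  | startMove (x y : V) (B : List V) :
      IsEdgeOfPath s x y → HomotopyMove M F s t (x :: B) (y :: x :: B)
  | startMoveReverse (x y : V) (B : List V) :
      IsEdgeOfPath s x y → HomotopyMove M F s t (y :: x :: B) (x :: B)
  | endMove (x y : V) (A : List V) :
      IsEdgeOfPath t x y → HomotopyMove M F s t (A ++ [x]) (A ++ [x, y])
  | endMoveReverse (x y : V) (A : List V) :
      IsEdgeOfPath t x y → HomotopyMove M F s t (A ++ [x, y]) (A ++ [x])
  | startEdgeSlide (F₁ : M.Face) (x y z : V) (B : List V) :
      IsEdgeOfPath s x y → F₁ ≠ F → M.faceVerts F₁ = {x, y, z} →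
      HomotopyMove M F s t (x :: z :: B) (y :: z :: B)
  | endEdgeSlide (F₁ : M.Face) (x y z : V) (A : List V) :
      IsEdgeOfPath t x y → F₁ ≠ F → M.faceVerts F₁ = {x, y, z} →
      HomotopyMove M F s t (A ++ [z, x]) (A ++ [z, y])

/-- A (discrete) simple homotopy `h₀, …, h_W` of the embedded graph with outer face `F`. -/
structure SimpleHomotopy {V : Type*} {G : SimpleGraph V} (M : RotationSystem G)
    (F : M.Face) where
  W : ℕ
  curve : Fin (W + 1) → List V
  u : V
  v : V
  w : V
  outer : M.faceVerts F = {u, v, w}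
  u_ne_v : u ≠ v
  /-- the two paths into which `u` and `v` split the boundary of the outer face -/
  s : List V
  t : List V
  subpaths : (s = [u, v] ∧ t = [u, w, v]) ∨ (s = [u, w, v] ∧ t = [u, v])
  /-- every curve is a walk in `G` -/
  walk : ∀ i, (curve i).IsChain G.Adj
  first : curve 0 = [u]
  last : curve (Fin.last W) = [v]
  starts_on : ∀ i, ∃ a ∈ s, (curve i).head? = some a
  ends_on : ∀ i, ∃ a ∈ t, (curve i).getLast? = some a
  move : ∀ i : Fin W, HomotopyMove M F s t (curve i.castSucc) (curve i.succ)
  /-- every curve is a simple path -/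
  simple : ∀ i, (curve i).Nodup
  /-- a vertex on two curves is on all curves in between -/
  consecutive : ∀ i j k : Fin (W + 1), i ≤ j → j ≤ k →
    ∀ a, a ∈ curve i → a ∈ curve k → a ∈ curve j

/-- The largest number of vertices on a curve of the homotopy. -/
def SimpleHomotopy.height {V : Type*} {G : SimpleGraph V} {M : RotationSystem G}
    {F : M.Face} (h : SimpleHomotopy M F) : ℕ :=
  Finset.univ.sup fun i => (h.curve i).length

/-- The `W × H`-grid; the first coordinate is the column, the second one the row. -/
def gridGraph (W H : ℕ) : SimpleGraph (Fin W × Fin H) :=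
  (SimpleGraph.pathGraph W).boxProd (SimpleGraph.pathGraph H)

/-- A grid-representation of `G` on the `W × H`-grid. -/
structure GridRep {V : Type*} (G : SimpleGraph V) (W H : ℕ) where
  label : Fin W × Fin H → V
  surjective : Function.Surjective label
  connected : ∀ a : V, ((gridGraph W H).induce {p | label p = a}).Connected
  edges : ∀ a b : V, G.Adj a b → ∃ p q, (gridGraph W H).Adj p q ∧ label p = a ∧ label q = b

/-- In every column, the points with a given label form a (possibly empty) path. -/
def GridRep.IsSimple {V : Type*} {G : SimpleGraph V} {W H : ℕ} (R : GridRep G W H) : Prop :=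
  ∀ (c : Fin W) (a : V),
    ((gridGraph W H).induce {p | p.1 = c ∧ R.label p = a}).Preconnected

/-- The regions of different vertices share a unit segment only if the vertices are adjacent;
together with `GridRep.edges` this makes `G` the contact graph of the regions. -/
def GridRep.IsContact {V : Type*} {G : SimpleGraph V} {W H : ℕ} (R : GridRep G W H) : Prop :=
  ∀ p q, (gridGraph W H).Adj p q → R.label p ≠ R.label q → G.Adj (R.label p) (R.label q)

namespace SimpleGraph

variable {V : Type*}

/-- A triangulated planar graph. -/
def IsTriangulatedPlanar (G : SimpleGraph V) : Prop :=
  ∃ M : RotationSystem G, M.IsTriangulation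

/-- The simple grid-major height (`⊤` if there is no simple representation). -/
noncomputable def sGMh (G : SimpleGraph V) : ℕ∞ :=
  ⨅ (H : ℕ) (W : ℕ) (R : GridRep G W H) (_ : R.IsSimple), (H : ℕ∞)

/-- The simple homotopy height: the minimum height of a simple homotopy over all planar
embeddings and all choices of the outer face (`⊤` if there is no simple homotopy). -/
noncomputable def sHh (G : SimpleGraph V) : ℕ∞ :=
  ⨅ (M : RotationSystem G) (_ : M.IsTriangulation) (F : M.Face) (h : SimpleHomotopy M F),
    (h.height : ℕ∞)

end SimpleGraph

/-! Write each curve of the homotopy as a column of height `k` by repeating vertices. Since the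
curve is a simple path, equal labels are contiguous in the column and neighbouring entries are equal
or adjacent. All surplus height sits at one vertex and can be shifted along the curve through
intermediate columns. Each move inserts, deletes or replaces a single vertex; with the surplus first
shifted next to that vertex (or onto it), the columns before and after the move fit together
(`IsFatColumn.exists_of_move`). A vertex common to two neighbouring columns has the same label in
both at some row, so consecutivity of its curves makes its region connected.

It remains that every edge becomes a contact. Every edge lies on an inner face, and a move that
sweeps a face makes all three of its edges touch, along a curve or through an exchange of two
vertices. That every inner face is swept is a homology argument mod 2. Close each curve along `s`
and `t` to a chain of edges; each move adds the boundaries of the faces it sweeps. The chain starts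
at zero and ends as the boundary of the outer face, so the swept faces (counted mod 2) together with
the outer face have zero boundary. As the dual graph is connected, this set contains all faces:
every inner face is swept an odd number of times (`SimpleHomotopy.exists_isShown`). -/

/-! ### Columns as stretched curves -/

/-- `c` arises from `p` by repeating entries. -/
inductive Stutter {V : Type*} : List V → List V → Prop
  | nil : Stutter [] []
  | cons (x : V) {p c : List V} : Stutter p c → Stutter (x :: p) (x :: c)
  | dup (x : V) {p c : List V} : Stutter (x :: p) c → Stutter (x :: p) (x :: c)

namespace Stutter

variable {V : Type*} {p q c d : List V}

theorem refl : ∀ p : List V, Stutter p p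
  | [] => nil
  | x :: p => cons x (refl p)

theorem append (h : Stutter p c) (h' : Stutter q d) : Stutter (p ++ q) (c ++ d) := by
  induction h with
  | nil => exact h'
  | cons x _ ih => exact cons x ih
  | dup x _ ih => exact dup x ih

theorem replicate_succ (x : V) (n : ℕ) : Stutter [x] (List.replicate (n + 1) x) := by
  induction n with
  | zero => exact refl _
  | succ n ih => exact dup x ih

theorem mem_iff (h : Stutter p c) (a : V) : a ∈ c ↔ a ∈ p := by
  induction h with
  | nil => rfl
  | cons x _ ih => simp [ih]
  | dup x _ ih => simp [ih]

theorem head_eq (h : Stutter p c) : c.head? = p.head? := by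
  cases h <;> rfl

/-- The last copy of `x` stands directly before the first copy of `y`. -/
theorem infix_pair (h : Stutter p c) {x y : V} (hp : [x, y] <:+: p) : [x, y] <:+: c := by
  induction h with
  | nil => exact hp
  | @cons z p c h ih =>
    rw [List.infix_cons_iff] at hp ⊢
    refine hp.imp (fun hp => ?_) ih
    obtain ⟨l, hl⟩ := hp
    simp only [List.cons_append, List.nil_append, List.cons.injEq] at hl
    obtain ⟨rfl, rfl⟩ := hl
    have := h.head_eq
    cases c with
    | nil => simp at this
    | cons w c =>
      simp only [List.head?_cons, Option.some.injEq] at this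
      subst this
      exact ⟨c, rfl⟩
  | dup z _ ih => exact (ih hp).trans (List.suffix_cons _ _).isInfix

theorem isChain {R : V → V → Prop} (h : Stutter p c) (hp : p.IsChain R) :
    c.IsChain fun x y => x = y ∨ R x y := by
  induction h with
  | nil => exact List.isChain_nil
  | @cons z p c h ih =>
    rw [List.isChain_cons] at hp ⊢
    refine ⟨fun y hy => Or.inr (hp.1 y ?_), ih hp.2⟩
    rwa [← h.head_eq]
  | dup z h ih =>
    rw [List.isChain_cons]
    refine ⟨fun y hy => Or.inl ?_, ih hp⟩
    rw [h.head_eq] at hy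
    simpa using hy

/-- Copies made from one entry are contiguous, and no other entry of `p` equals it. This gives
simplicity of the representation. -/
theorem eq_of_between {l : List V} (h : Stutter p l) (hp : p.Nodup) {a : V} {i j k : ℕ}
    (hij : i ≤ j) (hjk : j ≤ k) (hi : l[i]? = some a) (hk : l[k]? = some a) :
    l[j]? = some a := by
  induction h generalizing i j k with
  | nil => simp at hi
  | @cons z p c h ih =>
    rw [List.nodup_cons] at hp
    rcases i with _ | i
    · simp only [List.getElem?_cons_zero, Option.some.injEq] at hi
      subst hi
      rcases k with _ | k
      · obtain rfl : j = 0 := by omega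
        rfl
      · exact absurd ((h.mem_iff z).1 (List.mem_of_getElem? hk)) hp.1
    · obtain ⟨j, rfl⟩ : ∃ j', j = j' + 1 := ⟨j - 1, by omega⟩
      obtain ⟨k, rfl⟩ : ∃ k', k = k' + 1 := ⟨k - 1, by omega⟩
      exact ih hp.2 (Nat.le_of_succ_le_succ hij) (Nat.le_of_succ_le_succ hjk) hi hk
  | @dup z p c h ih =>
    rcases k with _ | k
    · obtain rfl : j = 0 := by omega
      exact hk
    · rcases j with _ | j
      · obtain rfl : i = 0 := by omega
        exact hi
      · rcases i with _ | i
        · simp only [List.getElem?_cons_zero, Option.some.injEq] at hi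
          subst hi
          refine ih hp (Nat.zero_le j) (Nat.le_of_succ_le_succ hjk) ?_ hk
          simpa [List.head?_eq_getElem?] using h.head_eq
        · exact ih hp (Nat.le_of_succ_le_succ hij) (Nat.le_of_succ_le_succ hjk) hi hk

end Stutter

/-! ### Compatibility of neighbouring columns -/

/-- Two columns that may stand next to each other in a contact representation. -/
structure Compatible {V : Type*} (G : SimpleGraph V) (c d : List V) : Prop where
  length_eq : c.length = d.length
  eq_or_adj : ∀ x y, (x, y) ∈ c.zip d → x = y ∨ G.Adj x y
  overlap : ∀ a, a ∈ c → a ∈ d → (a, a) ∈ c.zip d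

namespace Compatible

variable {V : Type*} {G : SimpleGraph V} {c d : List V}

theorem mem_zip_comm {x y : V} : (x, y) ∈ c.zip d ↔ (y, x) ∈ d.zip c := by
  rw [← List.zip_swap d c, List.mem_map]
  constructor
  · rintro ⟨⟨a, b⟩, h, hab⟩
    cases hab
    exact h
  · exact fun h => ⟨_, h, rfl⟩

theorem symm (h : Compatible G c d) : Compatible G d c where
  length_eq := h.length_eq.symm
  eq_or_adj x y hxy := (h.eq_or_adj y x (mem_zip_comm.1 hxy)).imp Eq.symm SimpleGraph.Adj.symm
  overlap a hd hc := mem_zip_comm.1 (h.overlap a hc hd)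

theorem mem_zip_self {l : List V} {x y : V} : (x, y) ∈ l.zip l ↔ x ∈ l ∧ x = y := by
  induction l with
  | nil => simp
  | cons z l ih => simp only [List.zip_cons_cons, List.mem_cons, Prod.mk.injEq, ih]; grind

theorem mem_zip_replace (P Q : List V) (n : ℕ) (x z a b : V) :
    (a, b) ∈ (P ++ List.replicate n x ++ Q).zip (P ++ List.replicate n z ++ Q) ↔
      ((a ∈ P ∨ a ∈ Q) ∧ a = b) ∨ (n ≠ 0 ∧ a = x ∧ b = z) := by
  rw [List.zip_append (by simp), List.zip_append rfl, List.zip_replicate']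
  simp only [List.mem_append, mem_zip_self, List.mem_replicate, Prod.mk.injEq]
  tauto

/-- Outside the block the columns agree; since `x ≠ z`, a common label must occur in `P` or `Q`,
where it overlaps itself. All horizontal transitions below are of this form or its inverse. -/
theorem replace (P Q : List V) (n : ℕ) {x z : V} (h : G.Adj x z) :
    Compatible G (P ++ List.replicate n x ++ Q) (P ++ List.replicate n z ++ Q) where
  length_eq := by simp
  eq_or_adj a b hab := by
    rw [mem_zip_replace] at hab
    rcases hab with ⟨_, rfl⟩ | ⟨_, rfl, rfl⟩
    · exact Or.inl rfl
    · exact Or.inr h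
  overlap a hc hd := by
    rw [mem_zip_replace]
    simp only [List.mem_append, List.mem_replicate] at hc hd
    have := h.ne
    grind

end Compatible

/-! ### Shifting the surplus height along a curve -/

/-- Compatible columns of height `k` that show the same curve `p`. -/
structure ColumnShift {V : Type*} (G : SimpleGraph V) (k : ℕ) (p c d : List V) : Prop where
  left : Stutter p c
  right : Stutter p d
  length_eq : c.length = k
  compatible : Compatible G c d

namespace ColumnShift

variable {V : Type*} {G : SimpleGraph V} {k : ℕ} {p c d : List V}

theorem symm (h : ColumnShift G k p c d) : ColumnShift G k p d c :=
  ⟨h.right, h.left, h.compatible.length_eq ▸ h.length_eq, h.compatible.symm⟩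

/-- The last copy of `x` is relabelled `y`, one copy at a time. One `x` always remains, so every
intermediate column still shows the same curve. -/
theorem move_one (P Q : List V) {x y : V} (h : G.Adj x y) (a b : ℕ)
    (hk : P.length + a + b + Q.length + 2 = k) :
    Relation.ReflTransGen (ColumnShift G k (P ++ x :: y :: Q))
      (P ++ List.replicate (a + 1) x ++ (List.replicate (b + 1) y ++ Q))
      (P ++ x :: (List.replicate (a + b + 1) y ++ Q)) := by
  induction a generalizing b with
  | zero => simpa using Relation.ReflTransGen.refl
  | succ a ih =>
    have hrec := ih (b + 1) (by omega)
    rw [show a + (b + 1) + 1 = a + 1 + b + 1 by omega] at hrec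
    refine Relation.ReflTransGen.head ?_ hrec
    have key : ∀ m n, Stutter (P ++ x :: y :: Q)
        (P ++ List.replicate (m + 1) x ++ (List.replicate (n + 1) y ++ Q)) := fun m n => by
      simpa using ((Stutter.refl P).append (Stutter.replicate_succ x m)).append
        ((Stutter.replicate_succ y n).append (Stutter.refl Q))
    refine ⟨key _ _, key _ _, by simp; omega, ?_⟩
    have := Compatible.replace (P ++ List.replicate (a + 1) x)
      (List.replicate (b + 1) y ++ Q) 1 h
    convert this using 1
    · rw [List.replicate_succ' (n := a + 1)]; simp
    · rw [List.replicate_succ (n := b + 1)]; simp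

theorem reflTransGen_symm (h : Relation.ReflTransGen (ColumnShift G k p) c d) :
    Relation.ReflTransGen (ColumnShift G k p) d c := by
  have : Std.Symm (ColumnShift G k p) := ⟨fun _ _ => symm⟩
  exact Relation.ReflTransGen.stdSymm.symm _ _ h

theorem to_head {m : ℕ} (P : List V) (x : V) (Q : List V) (h₀ : V) (t : List V)
    (h : h₀ :: t = P ++ x :: Q)
    (hp : (h₀ :: t).IsChain G.Adj) (hk : t.length + (m + 1) = k) :
    Relation.ReflTransGen (ColumnShift G k (h₀ :: t))
      (List.replicate (m + 1) h₀ ++ t) (P ++ List.replicate (m + 1) x ++ Q) := by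
  induction P using List.reverseRecOn generalizing x Q with
  | nil =>
    simp only [List.nil_append, List.cons.injEq] at h
    obtain ⟨rfl, rfl⟩ := h
    exact Relation.ReflTransGen.refl
  | append_singleton P y ih =>
    have h' : h₀ :: t = P ++ y :: x :: Q := by simpa using h
    refine (ih y (x :: Q) h').trans ?_
    have hadj : G.Adj y x := by
      rw [h', List.isChain_append] at hp
      exact (List.isChain_cons_cons.1 hp.2.1).1
    have hl := congrArg List.length h'
    simp only [List.length_cons, List.length_append] at hl
    -- With `b = 0` there is a single `y`-side entry at first; afterwards all `m` surplus copies
    -- belong to it.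
    have := move_one (G := G) (k := k) P Q hadj m 0 (by omega)
    rw [← h'] at this
    simpa using this

/-- The surplus height can be moved from any vertex of the curve to any other one. -/
theorem reflTransGen {m : ℕ} (P : List V) (x : V) (Q : List V) (P' : List V) (x' : V)
    (Q' : List V) (h : p = P ++ x :: Q) (h' : p = P' ++ x' :: Q') (hp : p.IsChain G.Adj)
    (hk : p.length + m = k) :
    Relation.ReflTransGen (ColumnShift G k p)
      (P ++ List.replicate (m + 1) x ++ Q) (P' ++ List.replicate (m + 1) x' ++ Q') := by
  cases p with
  | nil => simp at h
  | cons h₀ t =>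
    have hk' : t.length + (m + 1) = k := by simp only [List.length_cons] at hk; omega
    exact (reflTransGen_symm (to_head P x Q h₀ t h hp hk')).trans
      (to_head P' x' Q' h₀ t h' hp hk')

end ColumnShift

/-! ### Columns on both sides of a single move -/

/-- Two curves that differ in a single vertex. -/
inductive ElementaryMove {V : Type*} (G : SimpleGraph V) : List V → List V → Prop
  | insert (P Q : List V) (z : V) : P ++ Q ≠ [] → ElementaryMove G (P ++ Q) (P ++ z :: Q)
  | delete (P Q : List V) (z : V) : P ++ Q ≠ [] → ElementaryMove G (P ++ z :: Q) (P ++ Q)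
  | replace (P Q : List V) (x y : V) : G.Adj x y →
      ElementaryMove G (P ++ x :: Q) (P ++ y :: Q)

/-- `x` is replaced by `y` when the curve `p` moves to `q`. -/
def Exchanged {V : Type*} (p q : List V) (x y : V) : Prop :=
  x ∈ p ∧ x ∉ q ∧ y ∈ q ∧ y ∉ p

/-- `c` is a column of height `k` for the curve `p` with all surplus height at one vertex. -/
def IsFatColumn {V : Type*} (k : ℕ) (p c : List V) : Prop :=
  ∃ P x Q m, p = P ++ x :: Q ∧ p.length + m = k ∧ c = P ++ List.replicate (m + 1) x ++ Q

namespace IsFatColumn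

variable {V : Type*} {G : SimpleGraph V} {k : ℕ} {p q c d : List V}

theorem stutter (h : IsFatColumn k p c) : Stutter p c := by
  obtain ⟨P, x, Q, m, rfl, -, rfl⟩ := h
  simpa using ((Stutter.refl P).append (Stutter.replicate_succ x m)).append (Stutter.refl Q)

theorem length_eq (h : IsFatColumn k p c) : c.length = k := by
  obtain ⟨P, x, Q, m, rfl, h, rfl⟩ := h
  simp at h ⊢
  omega

theorem reflTransGen (h : IsFatColumn k p c) (h' : IsFatColumn k p d) (hp : p.IsChain G.Adj) :
    Relation.ReflTransGen (ColumnShift G k p) c d := by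
  obtain ⟨P, x, Q, m, e, hm, rfl⟩ := h
  obtain ⟨P', x', Q', m', e', hm', rfl⟩ := h'
  obtain rfl : m = m' := by omega
  exact ColumnShift.reflTransGen P x Q P' x' Q' e e' hp hm

/-- A neighbour `x` of `z` on the longer curve first carries the surplus, as a block of `m + 2`
copies. All but one of them turn into `z`; the remaining copy is at the end of the block away from
`z`'s place. -/
theorem exists_of_insert (P Q : List V) (z : V) (hne : P ++ Q ≠ [])
    (hq : (P ++ z :: Q).IsChain G.Adj) (hk : (P ++ z :: Q).length ≤ k) :
    ∃ c d, IsFatColumn k (P ++ Q) c ∧ IsFatColumn k (P ++ z :: Q) d ∧ Compatible G c d := by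
  obtain ⟨m, rfl⟩ := Nat.exists_eq_add_of_le hk
  rcases List.eq_nil_or_concat' P with rfl | ⟨P, x, rfl⟩
  · cases Q with
    | nil => simp at hne
    | cons x Q =>
      have hadj : G.Adj x z := by simpa using (List.isChain_cons_cons.1 hq).1.symm
      refine ⟨_, _, ⟨[], x, Q, m + 1, rfl, by simp; omega, rfl⟩,
        ⟨[], z, x :: Q, m, rfl, rfl, rfl⟩, ?_⟩
      convert Compatible.replace [] (x :: Q) (m + 1) hadj using 1
      rw [List.replicate_succ' (n := m + 1)]
      simp
  · have hadj : G.Adj x z := by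
      rw [List.append_assoc, List.isChain_append] at hq
      exact (List.isChain_cons_cons.1 hq.2.1).1
    refine ⟨_, _, ⟨P, x, Q, m + 1, by simp, by simp; omega, rfl⟩,
      ⟨P ++ [x], z, Q, m, rfl, rfl, rfl⟩, ?_⟩
    convert Compatible.replace (P ++ [x]) Q (m + 1) hadj using 1
    rw [List.replicate_succ (n := m + 1)]
    simp

theorem exists_of_move (h : ElementaryMove G p q) (hp : p.IsChain G.Adj) (hq : q.IsChain G.Adj)
    (hpk : p.length ≤ k) (hqk : q.length ≤ k) :
    ∃ c d, IsFatColumn k p c ∧ IsFatColumn k q d ∧ Compatible G c d ∧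
      ∀ x y, Exchanged p q x y → (x, y) ∈ c.zip d := by
  cases h with
  | insert P Q z hne =>
    obtain ⟨c, d, hc, hd, h⟩ := exists_of_insert P Q z hne hq hqk
    refine ⟨c, d, hc, hd, h, fun x y hxy => ?_⟩
    -- An insertion loses no vertex, so nothing is exchanged.
    unfold Exchanged at hxy
    simp only [List.mem_append, List.mem_cons] at hxy
    tauto
  | delete P Q z hne =>
    obtain ⟨c, d, hc, hd, h⟩ := exists_of_insert P Q z hne hp hpk
    refine ⟨d, c, hd, hc, h.symm, fun x y hxy => ?_⟩
    unfold Exchanged at hxy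
    simp only [List.mem_append, List.mem_cons] at hxy
    tauto
  | replace P Q x y hadj =>
    -- The replaced vertex carries all the surplus, and its whole block is relabelled.
    obtain ⟨m, rfl⟩ := Nat.exists_eq_add_of_le hpk
    refine ⟨_, _, ⟨P, x, Q, m, rfl, rfl, rfl⟩, ⟨P, y, Q, m, rfl, by simp, rfl⟩,
      Compatible.replace P Q (m + 1) hadj, fun a b hab => ?_⟩
    rw [Compatible.mem_zip_replace]
    unfold Exchanged at hab
    simp only [List.mem_append, List.mem_cons] at hab
    right
    grind

end IsFatColumn

/-! ### The sequence of all columns -/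

/-- One step between columns of height `k` for the curves `g 0, g 1, …`: the column of the curve
with index `a.1` is followed by another one for the same curve or for the next one. -/
structure SweepStep {V : Type*} (G : SimpleGraph V) (k : ℕ) (g : ℕ → List V)
    (a b : ℕ × List V) : Prop where
  left : Stutter (g a.1) a.2
  right : Stutter (g b.1) b.2
  length_eq : a.2.length = k
  compatible : Compatible G a.2 b.2
  index : b.1 = a.1 ∨ b.1 = a.1 + 1
  exchange : b.1 = a.1 + 1 → ∀ x y, Exchanged (g a.1) (g b.1) x y → (x, y) ∈ a.2.zip b.2

theorem Relation.ReflTransGen.exists_seq {α : Type*} {r : α → α → Prop} {a b : α}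
    (h : Relation.ReflTransGen r a b) :
    ∃ (N : ℕ) (f : ℕ → α), f 0 = a ∧ f N = b ∧ ∀ j < N, r (f j) (f (j + 1)) := by
  induction h using Relation.ReflTransGen.head_induction_on with
  | refl => exact ⟨0, fun _ => b, rfl, rfl, by simp⟩
  | @head a c hac _ ih =>
    obtain ⟨N, f, h0, hN, hf⟩ := ih
    refine ⟨N + 1, fun j => Nat.casesOn j a f, rfl, hN, fun j hj => ?_⟩
    cases j with
    | zero => simpa [h0] using hac
    | succ j => exact hf j (by omega)

section Sweep

variable {V : Type*} {G : SimpleGraph V} {k W : ℕ} {g : ℕ → List V}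

theorem reflTransGen_sweepStep (hchain : ∀ i ≤ W, (g i).IsChain G.Adj)
    (hne : ∀ i ≤ W, g i ≠ []) (hlen : ∀ i ≤ W, (g i).length ≤ k)
    (hmove : ∀ i < W, ElementaryMove G (g i) (g (i + 1))) :
    ∃ c d, IsFatColumn k (g 0) c ∧ IsFatColumn k (g W) d ∧
      Relation.ReflTransGen (SweepStep G k g) (0, c) (W, d) := by
  -- Between two moves, the surplus travels from where the previous move leaves it to where the next
  -- one needs it.
  have shift : ∀ i ≤ W, ∀ c d, IsFatColumn k (g i) c → IsFatColumn k (g i) d →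
      Relation.ReflTransGen (SweepStep G k g) (i, c) (i, d) := fun i hi c d hc hd => by
    refine (hc.reflTransGen hd (hchain i hi)).lift (fun c => (i, c)) fun c d h => ?_
    exact ⟨h.left, h.right, h.length_eq, h.compatible, Or.inl rfl, fun h => by simp at h⟩
  induction W with
  | zero =>
    obtain ⟨x, Q, hx⟩ := List.exists_cons_of_ne_nil (hne 0 le_rfl)
    obtain ⟨m, hm⟩ := Nat.exists_eq_add_of_le (hlen 0 le_rfl)
    have : IsFatColumn k (g 0) (List.replicate (m + 1) x ++ Q) :=
      ⟨[], x, Q, m, hx, hm.symm, rfl⟩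
    exact ⟨_, _, this, this, Relation.ReflTransGen.refl⟩
  | succ W ih =>
    obtain ⟨c, d, hc, hd, h⟩ := ih (fun i hi => hchain i (by omega)) (fun i hi => hne i (by omega))
      (fun i hi => hlen i (by omega)) (fun i hi => hmove i (by omega))
      (fun i hi => shift i (by omega))
    obtain ⟨c', d', hc', hd', hcd, hex⟩ := IsFatColumn.exists_of_move (hmove W (by omega))
      (hchain W (by omega)) (hchain (W + 1) le_rfl) (hlen W (by omega)) (hlen (W + 1) le_rfl)
    refine ⟨c, d', hc, hd', (h.trans (shift W (by omega) d c' hd hc')).tail ?_⟩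
    exact ⟨hc'.stutter, hd'.stutter, hc'.length_eq, hcd, Or.inr rfl, fun _ => hex⟩

/-- The columns of a representation as functions, together with the index of the curve that each
of them shows. -/
structure Sweep (G : SimpleGraph V) (k W : ℕ) (g : ℕ → List V) (N : ℕ) where
  idx : ℕ → ℕ
  col : ℕ → Fin k → V
  idx_zero : idx 0 = 0
  idx_last : idx N = W
  idx_succ : ∀ j < N, idx (j + 1) = idx j ∨ idx (j + 1) = idx j + 1
  mem_iff : ∀ j ≤ N, ∀ a, (∃ r, col j r = a) ↔ a ∈ g (idx j)
  vertical : ∀ j ≤ N, ∀ r r' : Fin k, r.val + 1 = r'.val →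
    col j r = col j r' ∨ G.Adj (col j r) (col j r')
  between : ∀ j ≤ N, ∀ r₁ r₂ r₃, r₁ ≤ r₂ → r₂ ≤ r₃ → ∀ a, col j r₁ = a → col j r₃ = a →
    col j r₂ = a
  pair : ∀ j ≤ N, ∀ x y, [x, y] <:+: g (idx j) →
    ∃ r r' : Fin k, r.val + 1 = r'.val ∧ col j r = x ∧ col j r' = y
  horizontal : ∀ j < N, ∀ r, col j r = col (j + 1) r ∨ G.Adj (col j r) (col (j + 1) r)
  overlap : ∀ j < N, ∀ a, a ∈ g (idx j) → a ∈ g (idx (j + 1)) →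
    ∃ r, col j r = a ∧ col (j + 1) r = a
  exchange : ∀ j < N, idx (j + 1) = idx j + 1 →
    ∀ x y, Exchanged (g (idx j)) (g (idx (j + 1))) x y → ∃ r, col j r = x ∧ col (j + 1) r = y

theorem exists_sweep (hchain : ∀ i ≤ W, (g i).IsChain G.Adj) (hnodup : ∀ i ≤ W, (g i).Nodup)
    (hne : ∀ i ≤ W, g i ≠ []) (hlen : ∀ i ≤ W, (g i).length ≤ k)
    (hmove : ∀ i < W, ElementaryMove G (g i) (g (i + 1))) :
    ∃ N, Nonempty (Sweep G k W g N) := by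
  obtain ⟨c, d, hc, hd, h⟩ := reflTransGen_sweepStep hchain hne hlen hmove
  obtain ⟨N, f, h0, hN, hf⟩ := h.exists_seq
  -- Default value for `getD`, never returned: all columns up to index `N` have length `k`.
  have v₀ : V := (g 0).head (hne 0 (Nat.zero_le W))
  have hst : ∀ j ≤ N, Stutter (g (f j).1) (f j).2 ∧ (f j).2.length = k := fun j hj => by
    rcases hj.lt_or_eq with hj | rfl
    · exact ⟨(hf j hj).left, (hf j hj).length_eq⟩
    · rw [hN]
      exact ⟨hd.stutter, hd.length_eq⟩
  have hidx : ∀ j ≤ N, (f j).1 ≤ W := fun j hj => by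
    -- Backward induction from column `N`: curve indices never decrease and end at `W`.
    have : ∀ n, ∀ j, j + n = N → (f j).1 ≤ W := fun n => by
      induction n with
      | zero => rintro j rfl; simp only [add_zero] at hN; rw [hN]
      | succ n ih =>
        intro j hj
        have h1 := ih (j + 1) (by omega)
        have h2 := (hf j (by omega)).index
        omega
    exact this (N - j) j (by omega)
  have hget : ∀ j ≤ N, ∀ r : Fin k, (f j).2[r.val]? = some ((f j).2.getD r.val v₀) :=
    fun j hj r => by
      have := (hst j hj).2
      rw [List.getD_eq_getElem?_getD, List.getElem?_eq_getElem (by omega)]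
      rfl
  have hlt : ∀ j ≤ N, ∀ r a, (f j).2[r]? = some a → r < k := fun j hj r a h => by
    rw [← (hst j hj).2]
    exact (List.getElem?_eq_some_iff.1 h).1
  have hzip : ∀ j < N, ∀ x y, (x, y) ∈ (f j).2.zip (f (j + 1)).2 → ∃ r : Fin k,
      (f j).2.getD r.val v₀ = x ∧ (f (j + 1)).2.getD r.val v₀ = y := fun j hj x y h => by
    obtain ⟨r, hr⟩ := List.mem_iff_getElem?.1 h
    rw [List.getElem?_zip_eq_some] at hr
    refine ⟨⟨r, hlt j hj.le r _ hr.1⟩, ?_, ?_⟩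
    · simp [List.getD_eq_getElem?_getD, hr.1]
    · simp [List.getD_eq_getElem?_getD, hr.2]
  have hmem : ∀ j ≤ N, ∀ a, (∃ r : Fin k, (f j).2.getD r.val v₀ = a) ↔ a ∈ g (f j).1 :=
    fun j hj a => by
      rw [← (hst j hj).1.mem_iff]
      constructor
      · rintro ⟨r, rfl⟩
        exact List.mem_of_getElem? (hget j hj r)
      · intro h
        obtain ⟨r, hr⟩ := List.mem_iff_getElem?.1 h
        exact ⟨⟨r, hlt j hj r _ hr⟩, by simp [List.getD_eq_getElem?_getD, hr]⟩
  refine ⟨N, ⟨fun j => (f j).1, fun j r => (f j).2.getD r.val v₀, by rw [h0], by rw [hN],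
    fun j hj => (hf j hj).index, hmem, ?_, ?_, ?_, ?_, ?_, ?_⟩⟩
  · intro j hj r r' hr
    have h1 := (hst j hj).1.isChain (hchain _ (hidx j hj))
    rw [List.isChain_iff_getElem] at h1
    have hl := (hst j hj).2
    have h2 := h1 r.val (by omega)
    have e1 := hget j hj r
    have e2 := hget j hj r'
    rw [List.getElem?_eq_getElem (by omega), Option.some.injEq] at e1 e2
    rw [← e1, ← e2]
    simpa only [hr] using h2
  · intro j hj r₁ r₂ r₃ h12 h23 a h1 h3
    have e1 := hget j hj r₁
    have e2 := hget j hj r₂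
    have e3 := hget j hj r₃
    rw [h1] at e1
    rw [h3] at e3
    have := (hst j hj).1.eq_of_between (hnodup _ (hidx j hj)) h12 h23 e1 e3
    rw [e2] at this
    simpa using this
  · intro j hj x y h
    obtain ⟨A, B, hAB⟩ := (hst j hj).1.infix_pair h
    have e1 : (f j).2[A.length]? = some x := by rw [← hAB]; simp
    have e2 : (f j).2[A.length + 1]? = some y := by rw [← hAB]; simp
    exact ⟨⟨_, hlt j hj _ _ e1⟩, ⟨_, hlt j hj _ _ e2⟩, rfl,
      by simp [List.getD_eq_getElem?_getD, e1], by simp [List.getD_eq_getElem?_getD, e2]⟩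
  · intro j hj r
    refine (hf j hj).compatible.eq_or_adj _ _ (List.mem_iff_getElem?.2 ⟨r.val, ?_⟩)
    rw [List.getElem?_zip_eq_some]
    exact ⟨hget j hj.le r, hget (j + 1) hj r⟩
  · intro j hj a h1 h2
    exact hzip j hj a a ((hf j hj).compatible.overlap a (((hf j hj).left.mem_iff a).2 h1)
      (((hf j hj).right.mem_iff a).2 h2))
  · intro j hj hs x y hxy
    exact hzip j hj x y ((hf j hj).exchange hs x y hxy)

/-! ### The labelled grid and connectivity of its regions -/

namespace Sweep

variable {N : ℕ} (S : Sweep G k W g N)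

theorem idx_mono {i j : ℕ} (hij : i ≤ j) (hj : j ≤ N) : S.idx i ≤ S.idx j := by
  induction j, hij using Nat.le_induction with
  | base => exact le_rfl
  | succ j _ ih =>
    have := S.idx_succ j (by omega)
    have := ih (by omega)
    omega

/-- Discrete intermediate value argument: the index rises from `0` to `W` in steps of at most one,
so every move of the homotopy occurs between two columns. -/
theorem exists_idx_eq {i : ℕ} (hi : i < W) :
    ∃ j < N, S.idx j = i ∧ S.idx (j + 1) = i + 1 := by
  by_contra! h
  have : ∀ j ≤ N, S.idx j ≤ i := fun j => by
    induction j with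
    | zero => simp [S.idx_zero]
    | succ j ih =>
      intro hj
      have h1 := ih (by omega)
      have h2 := S.idx_succ j (by omega)
      have h3 := h j (by omega)
      omega
  have := this N le_rfl
  have := S.idx_last
  omega

theorem gridGraph_adj {A B : ℕ} {p q : Fin A × Fin B} : (gridGraph A B).Adj p q ↔
    (p.1 = q.1 ∧ (p.2.val + 1 = q.2.val ∨ q.2.val + 1 = p.2.val)) ∨
    (p.2 = q.2 ∧ (p.1.val + 1 = q.1.val ∨ q.1.val + 1 = p.1.val)) := by
  unfold gridGraph
  rw [SimpleGraph.boxProd_adj, SimpleGraph.pathGraph_adj, SimpleGraph.pathGraph_adj]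
  tauto

/-- The labelling of the grid given by the columns. -/
def label (p : Fin (N + 1) × Fin k) : V := S.col p.1 p.2

theorem reachable_column (c : Fin (N + 1)) (a : V) (r r' : Fin k) (hr : S.label (c, r) = a)
    (hr' : S.label (c, r') = a) (hle : r ≤ r') :
    ((gridGraph (N + 1) k).induce {p | p.1 = c ∧ S.label p = a}).Reachable
      ⟨(c, r), rfl, hr⟩ ⟨(c, r'), rfl, hr'⟩ := by
  obtain ⟨n, hn⟩ := Nat.exists_eq_add_of_le (Fin.le_def.1 hle)
  induction n generalizing r' with
  | zero =>
    obtain rfl : r' = r := Fin.ext (by omega)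
    exact SimpleGraph.Reachable.refl _
  | succ n ih =>
    have hn' : r.val + n < k := by have := r'.isLt; omega
    have hmid : S.label (c, ⟨r.val + n, hn'⟩) = a :=
      S.between c (Nat.lt_succ_iff.1 c.isLt) r _ r' (Fin.le_def.2 (by simp))
        (Fin.le_def.2 (by simp; omega)) a hr hr'
    refine (ih ⟨r.val + n, hn'⟩ hmid (Fin.le_def.2 (by simp)) rfl).trans
      (SimpleGraph.Adj.reachable ?_)
    rw [SimpleGraph.induce_adj, gridGraph_adj]
    left
    refine ⟨rfl, Or.inl ?_⟩
    simp only
    omega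

theorem preconnected_column (c : Fin (N + 1)) (a : V) :
    ((gridGraph (N + 1) k).induce {p | p.1 = c ∧ S.label p = a}).Preconnected := by
  rintro ⟨⟨c₁, r⟩, h₁, hr⟩ ⟨⟨c₂, r'⟩, h₂, hr'⟩
  obtain rfl : c₁ = c := h₁
  obtain rfl : c₂ = c₁ := h₂
  rcases le_total r r' with h | h
  · exact S.reachable_column _ a r r' hr hr' h
  · exact (S.reachable_column _ a r' r hr' hr h).symm

theorem reachable_of_same_column {a : V} (p q : {p | S.label p = a}) (h : p.1.1 = q.1.1) :
    ((gridGraph (N + 1) k).induce {p | S.label p = a}).Reachable p q :=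
  (S.preconnected_column q.1.1 a ⟨p.1, h, p.2⟩ ⟨q.1, rfl, q.2⟩).map
    (SimpleGraph.induceHomOfLE _ (fun _ h => h.2)).toHom

/-- By consecutivity `a` occurs in the next column too, and `overlap` gives a row in which a
horizontal step stays within the label `a`. Columns are connected, so that row can be reached first.
-/
theorem reachable_of_le (hcons : ∀ i j l, i ≤ j → j ≤ l → l ≤ W → ∀ a, a ∈ g i → a ∈ g l → a ∈ g j)
    {a : V} (n : ℕ) (p q : {p | S.label p = a}) (h : p.1.1.val + n = q.1.1.val) :
    ((gridGraph (N + 1) k).induce {p | S.label p = a}).Reachable p q := by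
  induction n generalizing p with
  | zero => exact S.reachable_of_same_column p q (Fin.ext (by omega))
  | succ n ih =>
    have hq := q.1.1.isLt
    have hpN : p.1.1.val < N := by omega
    have hp : a ∈ g (S.idx p.1.1) := (S.mem_iff _ hpN.le a).1 ⟨p.1.2, p.2⟩
    have hq' : a ∈ g (S.idx q.1.1) := (S.mem_iff _ (by omega) a).1 ⟨q.1.2, q.2⟩
    have hmid : a ∈ g (S.idx (p.1.1 + 1)) :=
      hcons _ _ _ (S.idx_mono (by omega) (by omega)) (S.idx_mono (by omega) (by omega))
        ((S.idx_mono (by omega) le_rfl).trans_eq S.idx_last) a hp hq'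
    obtain ⟨r, h1, h2⟩ := S.overlap _ hpN a hp hmid
    let p₁ : {p | S.label p = a} := ⟨(p.1.1, r), h1⟩
    let p₂ : {p | S.label p = a} := ⟨(⟨p.1.1 + 1, by omega⟩, r), h2⟩
    refine (S.reachable_of_same_column p p₁ rfl).trans
      (SimpleGraph.Reachable.trans (SimpleGraph.Adj.reachable ?_) (ih p₂ (by simp [p₂]; omega)))
    rw [SimpleGraph.induce_adj, gridGraph_adj]
    exact Or.inr ⟨rfl, Or.inl rfl⟩

end Sweep

/-! ### From exposed edges to a contact representation -/

/-- The curves `p` and `q`, shown in consecutive columns, make `x` and `y` touch. -/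
def Exposes (p q : List V) (x y : V) : Prop :=
  IsEdgeOfPath p x y ∨ IsEdgeOfPath q x y ∨ Exchanged p q x y ∨ Exchanged p q y x

theorem Exposes.symm {p q : List V} {x y : V} (h : Exposes p q x y) : Exposes p q y x := by
  unfold Exposes IsEdgeOfPath at *
  tauto

/-- Edges of a curve become vertical contacts; an exchanged pair becomes a horizontal contact where
the curve index increases. -/
theorem exists_gridRep (hchain : ∀ i ≤ W, (g i).IsChain G.Adj) (hnodup : ∀ i ≤ W, (g i).Nodup)
    (hne : ∀ i ≤ W, g i ≠ []) (hlen : ∀ i ≤ W, (g i).length ≤ k)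
    (hmove : ∀ i < W, ElementaryMove G (g i) (g (i + 1)))
    (hcons : ∀ i j l, i ≤ j → j ≤ l → l ≤ W → ∀ a, a ∈ g i → a ∈ g l → a ∈ g j)
    (hedge : ∀ a b, G.Adj a b → ∃ i < W, Exposes (g i) (g (i + 1)) a b)
    (hdeg : ∀ a, ∃ b, G.Adj a b) :
    ∃ (N : ℕ) (R : GridRep G N k), R.IsSimple ∧ R.IsContact := by
  obtain ⟨N, ⟨S⟩⟩ := exists_sweep hchain hnodup hne hlen hmove
  have hpair : ∀ j ≤ N, ∀ a b, IsEdgeOfPath (g (S.idx j)) a b →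
      ∃ p q, (gridGraph (N + 1) k).Adj p q ∧ S.label p = a ∧ S.label q = b := by
    rintro j hj a b (h | h)
    · obtain ⟨r, r', hr, h1, h2⟩ := S.pair j hj _ _ h
      exact ⟨(⟨j, by omega⟩, r), (⟨j, by omega⟩, r'),
        Sweep.gridGraph_adj.2 (Or.inl ⟨rfl, Or.inl hr⟩), h1, h2⟩
    · obtain ⟨r, r', hr, h1, h2⟩ := S.pair j hj _ _ h
      exact ⟨(⟨j, by omega⟩, r'), (⟨j, by omega⟩, r),
        Sweep.gridGraph_adj.2 (Or.inl ⟨rfl, Or.inr hr⟩), h2, h1⟩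
  have hedges : ∀ a b, G.Adj a b →
      ∃ p q, (gridGraph (N + 1) k).Adj p q ∧ S.label p = a ∧ S.label q = b := by
    intro a b hab
    obtain ⟨i, hi, h⟩ := hedge a b hab
    obtain ⟨j, hj, rfl, hj'⟩ := S.exists_idx_eq hi
    rw [← hj'] at h
    rcases h with h | h | h | h
    · exact hpair j hj.le a b h
    · exact hpair (j + 1) hj a b h
    · obtain ⟨r, h1, h2⟩ := S.exchange j hj hj' _ _ h
      exact ⟨(⟨j, by omega⟩, r), (⟨j + 1, by omega⟩, r),
        Sweep.gridGraph_adj.2 (Or.inr ⟨rfl, Or.inl rfl⟩), h1, h2⟩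
    · obtain ⟨r, h1, h2⟩ := S.exchange j hj hj' _ _ h
      exact ⟨(⟨j + 1, by omega⟩, r), (⟨j, by omega⟩, r),
        Sweep.gridGraph_adj.2 (Or.inr ⟨rfl, Or.inr rfl⟩), h2, h1⟩
  -- Every vertex has an incident edge, and each edge has already been realized.
  have hsurj : Function.Surjective S.label := fun a => by
    obtain ⟨b, hb⟩ := hdeg a
    obtain ⟨p, _, _, hp, _⟩ := hedges a b hb
    exact ⟨p, hp⟩
  refine ⟨N + 1, ⟨S.label, hsurj, fun a => ?_, hedges⟩, S.preconnected_column, ?_⟩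
  · obtain ⟨p, hp⟩ := hsurj a
    have : Nonempty {p | S.label p = a} := ⟨⟨p, hp⟩⟩
    refine ⟨fun p q => ?_⟩
    rcases le_total p.1.1.val q.1.1.val with h | h
    · exact S.reachable_of_le hcons _ p q (Nat.add_sub_of_le h)
    · exact (S.reachable_of_le hcons _ q p (Nat.add_sub_of_le h)).symm
  · rintro ⟨j, r⟩ ⟨j', r'⟩ h hl
    simp only [Sweep.label] at hl ⊢
    have hj := j.isLt
    have hj' := j'.isLt
    rw [Sweep.gridGraph_adj] at h
    simp only at h
    rcases h with ⟨rfl, h | h⟩ | ⟨rfl, h | h⟩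
    · exact (S.vertical j (by omega) r r' h).resolve_left hl
    · exact ((S.vertical j (by omega) r' r h).resolve_left (Ne.symm hl)).symm
    · rw [← h] at hl ⊢
      exact (S.horizontal j (by omega) r).resolve_left hl
    · rw [← h] at hl ⊢
      exact ((S.horizontal j' (by omega) r).resolve_left (Ne.symm hl)).symm

end Sweep

/-! ### Faces of a triangulation and connectivity of the dual -/

namespace RotationSystem

variable {V : Type*} {G : SimpleGraph V} {M : RotationSystem G}

theorem faceOf_facePerm (d : G.Dart) : M.faceOf (M.facePerm d) = M.faceOf d :=
  Quotient.sound (Equiv.Perm.sameCycle_apply_left.2 (Equiv.Perm.SameCycle.refl _ _))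

theorem facePerm_fst (d : G.Dart) : (M.facePerm d).fst = d.snd := M.rot_fst d.symm

theorem rot_eq (d : G.Dart) : M.rot d = M.facePerm d.symm := by
  simp [facePerm]

theorem _root_.Equiv.Perm.SameCycle.mem_of_mapsTo {α : Type*} [Finite α] {f : Equiv.Perm α}
    {S : Set α} (hS : ∀ x ∈ S, f x ∈ S) {x y : α} (h : f.SameCycle x y) (hx : x ∈ S) : y ∈ S := by
  obtain ⟨n, rfl⟩ := h.exists_nat_pow_eq
  clear h
  induction n with
  | zero => exact hx
  | succ n ih =>
    rw [pow_succ', Equiv.Perm.mul_apply]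
    exact hS _ ih

/-- The three darts on the boundary of a face of a triangulation. -/
theorem exists_triangle [Finite V] (hM : M.IsTriangulation) (F : M.Face) :
    ∃ a b c : V, ∃ (hab : G.Adj a b) (hbc : G.Adj b c) (hca : G.Adj c a), ∀ d : G.Dart,
      M.faceOf d = F ↔ d = ⟨(a, b), hab⟩ ∨ d = ⟨(b, c), hbc⟩ ∨ d = ⟨(c, a), hca⟩ := by
  have : Finite G.Dart := Finite.of_injective _ SimpleGraph.Dart.toProd_injective
  have h3 := hM.2 F
  obtain ⟨d, hd⟩ : {d : G.Dart | M.faceOf d = F}.Nonempty := by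
    rw [← Set.ncard_pos]; omega
  have hd : M.faceOf d = F := hd
  set φ := M.facePerm with hφ
  have hF1 : M.faceOf (φ d) = F := (faceOf_facePerm d).trans hd
  have hF2 : M.faceOf (φ (φ d)) = F := (faceOf_facePerm _).trans hF1
  have hF3 : M.faceOf (φ (φ (φ d))) = F := (faceOf_facePerm _).trans hF2
  have hne : ∀ e : G.Dart, φ e ≠ e := fun e he => by
    have := M.facePerm_fst e
    rw [← hφ, he] at this
    exact e.adj.ne this
  -- Otherwise the orbit, hence the face, would contain only two darts.
  have h20 : φ (φ d) ≠ d := fun h => by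
    have hsub : {e : G.Dart | M.faceOf e = F} ⊆ {d, φ d} := fun e he => by
      have hs : φ.SameCycle d e := Quotient.exact (hd.trans (Eq.symm he))
      refine hs.mem_of_mapsTo ?_ (Set.mem_insert d _)
      rintro x (rfl | rfl)
      · exact Or.inr rfl
      · exact Or.inl h
    have := Set.ncard_le_ncard hsub (Set.toFinite _)
    rw [Set.ncard_pair (hne d).symm] at this
    omega
  have hset : {d, φ d, φ (φ d)} = {e : G.Dart | M.faceOf e = F} := by
    refine Set.eq_of_subset_of_ncard_le ?_ ?_ (Set.toFinite _)
    · rintro x (rfl | rfl | rfl)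
      exacts [hd, hF1, hF2]
    · rw [h3, Set.ncard_eq_three.2 ⟨d, φ d, φ (φ d), (hne d).symm, h20.symm, (hne _).symm, rfl⟩]
  have h30 : φ (φ (φ d)) = d := by
    have : φ (φ (φ d)) ∈ ({d, φ d, φ (φ d)} : Set G.Dart) := by rw [hset]; exact hF3
    rcases this with h | h | h
    · exact h
    · exact absurd (φ.injective h) h20
    · exact absurd h (hne _)
  have f1 : (φ d).fst = d.snd := M.facePerm_fst d
  have f2 : (φ (φ d)).fst = (φ d).snd := M.facePerm_fst _
  have f3 : d.fst = (φ (φ d)).snd := by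
    have := M.facePerm_fst (φ (φ d))
    rwa [← hφ, h30] at this
  refine ⟨d.fst, d.snd, (φ d).snd, d.adj, f1 ▸ (φ d).adj, ?_, fun e => ?_⟩
  · rw [f3, ← f2]; exact (φ (φ d)).adj
  · have he : e ∈ ({d, φ d, φ (φ d)} : Set G.Dart) ↔ M.faceOf e = F := by rw [hset]; rfl
    rw [← he]
    simp only [Set.mem_insert_iff, Set.mem_singleton_iff, SimpleGraph.Dart.ext_iff, Prod.ext_iff]
    rw [← f1, ← f2, f3]

theorem faceVerts_triangle {F : M.Face} {a b c : V} {hab : G.Adj a b} {hbc : G.Adj b c}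
    {hca : G.Adj c a} (h : ∀ d : G.Dart,
      M.faceOf d = F ↔ d = ⟨(a, b), hab⟩ ∨ d = ⟨(b, c), hbc⟩ ∨ d = ⟨(c, a), hca⟩) :
    M.faceVerts F = {a, b, c} := by
  ext x
  simp only [faceVerts, h, Set.mem_ofPred_eq, Set.mem_insert_iff, Set.mem_singleton_iff]
  constructor
  · rintro ⟨d, rfl | rfl | rfl, rfl⟩ <;> simp
  · rintro (rfl | rfl | rfl)
    exacts [⟨_, Or.inl rfl, rfl⟩, ⟨_, Or.inr (Or.inl rfl), rfl⟩, ⟨_, Or.inr (Or.inr rfl), rfl⟩]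

/-- The darts of a face run cyclically through three distinct vertices, so none is the reverse of
another. Hence every edge has an inner face on at least one side. -/
theorem faceOf_ne_faceOf_symm [Finite V] (hM : M.IsTriangulation) (d : G.Dart) :
    M.faceOf d ≠ M.faceOf d.symm := by
  intro hd
  obtain ⟨a, b, c, hab, hbc, hca, h⟩ := exists_triangle hM (M.faceOf d)
  have h1 := (h d).1 rfl
  have h2 := (h d.symm).1 hd.symm
  have := hab.ne
  have := hbc.ne
  have := hca.ne
  obtain ⟨⟨p, q⟩, hpq⟩ := d
  simp only [SimpleGraph.Dart.ext_iff, SimpleGraph.Dart.symm, Prod.swap, Prod.mk.injEq] at h1 h2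
  grind

open Classical in
/-- The indicator (mod 2) of the undirected edge `xy` at `pq`. -/
noncomputable def edgeInd (p q x y : V) : ZMod 2 :=
  if (p = x ∧ q = y) ∨ (p = y ∧ q = x) then 1 else 0

open Classical in
/-- The indicator (mod 2) of a face. -/
noncomputable def faceInd (F F' : M.Face) : ZMod 2 := if F' = F then 1 else 0

theorem edgeInd_comm (p q x y : V) : edgeInd p q x y = edgeInd p q y x := by
  unfold edgeInd
  grind

/-- The coboundary (in the dual graph) of a function on the faces. -/
def dualDiff (n : M.Face → ZMod 2) (d : G.Dart) : ZMod 2 :=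
  n (M.faceOf d) + n (M.faceOf d.symm)

/-- The vertices of a face of a triangulation are distinct and adjacent, and its boundary consists
of the three edges between them. -/
theorem face_spec [Finite V] (hM : M.IsTriangulation) {F : M.Face} {x y z : V}
    (hF : M.faceVerts F = {x, y, z}) :
    G.Adj x y ∧ G.Adj x z ∧ G.Adj y z ∧ ∀ d : G.Dart,
      dualDiff (faceInd F) d =
        edgeInd d.fst d.snd x y + edgeInd d.fst d.snd x z + edgeInd d.fst d.snd y z := by
  obtain ⟨a, b, c, hab, hbc, hca, h⟩ := exists_triangle hM F
  rw [faceVerts_triangle h] at hF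
  have ha : a = x ∨ a = y ∨ a = z := by simpa using hF.subset (by simp : a ∈ ({a, b, c} : Set V))
  have hb : b = x ∨ b = y ∨ b = z := by simpa using hF.subset (by simp : b ∈ ({a, b, c} : Set V))
  have hc : c = x ∨ c = y ∨ c = z := by simpa using hF.subset (by simp : c ∈ ({a, b, c} : Set V))
  have nab := hab.ne
  have nbc := hbc.ne
  have nca := hca.ne
  have key : ∀ d : G.Dart, dualDiff (faceInd F) d =
      edgeInd d.fst d.snd a b + edgeInd d.fst d.snd a c + edgeInd d.fst d.snd b c := by
    rintro ⟨⟨p, q⟩, hpq⟩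
    have npq : p ≠ q := hpq.ne
    have h₁ := h ⟨(p, q), hpq⟩
    have h₂ := h ⟨(q, p), hpq.symm⟩
    simp only [SimpleGraph.Dart.ext_iff, Prod.mk.injEq] at h₁ h₂
    simp only [dualDiff, faceInd, edgeInd, SimpleGraph.Dart.symm, Prod.swap]
    clear h hF ha hb hc
    grind
  have hab' := hab.symm
  have hbc' := hbc.symm
  have hca' := hca.symm
  -- Since `a`, `b`, `c` are distinct, only the six orderings of `x`, `y`, `z` survive.
  rcases ha with rfl | rfl | rfl <;> rcases hb with rfl | rfl | rfl <;>
    rcases hc with rfl | rfl | rfl <;> first | contradiction | skip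
  all_goals
    refine ⟨by assumption, by assumption, by assumption, fun d => ?_⟩
    refine (key d).trans ?_
    unfold edgeInd
    grind

/-- The dual of a connected embedded graph is connected. -/
theorem eq_of_dualDiff_eq_zero [Finite V] (hG : G.Connected) {n : M.Face → ZMod 2}
    (hn : ∀ d, dualDiff n d = 0) (d e : G.Dart) : n (M.faceOf d) = n (M.faceOf e) := by
  have : Finite G.Dart := Finite.of_injective _ SimpleGraph.Dart.toProd_injective
  have hsymm : ∀ d : G.Dart, n (M.faceOf d.symm) = n (M.faceOf d) := fun d => by
    have := hn d
    unfold dualDiff at this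
    exact (CharTwo.add_eq_zero.1 this).symm
  -- The next dart around a vertex lies on the face across `d`, so `n` is constant around each
  -- vertex; a walk in `G` then links any two vertices.
  have hrot : ∀ d : G.Dart, n (M.faceOf (M.rot d)) = n (M.faceOf d) := fun d => by
    rw [rot_eq, faceOf_facePerm, hsymm]
  have hfst : ∀ d e : G.Dart, d.fst = e.fst → n (M.faceOf e) = n (M.faceOf d) := fun d e h =>
    (M.sameCycle_of_fst_eq d e h).mem_of_mapsTo
      (S := {e | n (M.faceOf e) = n (M.faceOf d)}) (fun x hx => (hrot x).trans hx) rfl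
  obtain ⟨w⟩ := hG.preconnected d.fst e.fst
  generalize ha : d.fst = a at w
  generalize hb : e.fst = b at w
  induction w generalizing d with
  | nil => exact hfst e d (hb.trans ha.symm)
  | @cons a c b hac w ih =>
    rw [← ih ⟨(c, a), hac.symm⟩ rfl hb, ← hsymm ⟨(c, a), hac.symm⟩]
    exact hfst _ d ha.symm

end RotationSystem

/-! ### Chains of curves mod 2 and the effect of a move -/

section Coverage

open RotationSystem

variable {V : Type*}

/-- The number (mod 2) of traversals of the edge `pq` by a curve. -/
noncomputable def pathInd (p q : V) : List V → ZMod 2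
  | x :: y :: l => edgeInd p q x y + pathInd p q (y :: l)
  | _ => 0

theorem pathInd_singleton (p q x : V) : pathInd p q [x] = 0 := by
  simp [pathInd]

theorem pathInd_cons_cons (p q x y : V) (l : List V) :
    pathInd p q (x :: y :: l) = edgeInd p q x y + pathInd p q (y :: l) := by
  rw [pathInd]

theorem pathInd_append_cons (p q x : V) (A B : List V) :
    pathInd p q (A ++ x :: B) = pathInd p q (A ++ [x]) + pathInd p q (x :: B) := by
  induction A with
  | nil => simp [pathInd_singleton]
  | cons a A ih =>
    cases A with
    | nil => simp [pathInd_cons_cons, pathInd_singleton]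
    | cons b A =>
      simp only [List.cons_append, pathInd_cons_cons] at ih ⊢
      rw [ih, add_assoc]

theorem pathInd_append_cons_cons (p q x y : V) (A B : List V) :
    pathInd p q (A ++ x :: y :: B) =
      pathInd p q (A ++ [x]) + (edgeInd p q x y + pathInd p q (y :: B)) := by
  rw [pathInd_append_cons, pathInd_cons_cons]

/-- The chain of a curve, closed up along the boundary paths by means of potentials `σ` and
`τ` at its two ends. -/
noncomputable def closedInd (p q : V) (σ τ : V → ZMod 2) (l : List V) : ZMod 2 :=
  pathInd p q l + l.head?.elim 0 σ + l.getLast?.elim 0 τ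

/-- `σ` is a potential for the edges of the path `s`. -/
def IsPotential (p q : V) (s : List V) (σ : V → ZMod 2) : Prop :=
  ∀ x y, IsEdgeOfPath s x y → σ y = σ x + edgeInd p q x y

/-- The potential sums the edge indicator along the path from `u`, which is consistent because the
path repeats no vertex. -/
theorem exists_potential_of_pair (p q u v : V) (h : u ≠ v) :
    ∃ σ, IsPotential p q [u, v] σ ∧ σ u = 0 ∧ σ v = edgeInd p q u v := by
  classical
  refine ⟨fun x => if x = v then edgeInd p q u v else 0, fun x y hxy => ?_, by simp [h], by simp⟩
  simp only [IsEdgeOfPath, List.infix_cons_iff, List.infix_nil, List.cons_prefix_cons,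
    List.prefix_nil] at hxy
  have := edgeInd_comm p q u v
  grind

theorem exists_potential_of_triple (p q u w v : V) (huv : u ≠ v) (huw : u ≠ w) (hwv : w ≠ v) :
    ∃ σ, IsPotential p q [u, w, v] σ ∧ σ u = 0 ∧
      σ v = edgeInd p q u w + edgeInd p q w v := by
  classical
  refine ⟨fun x => if x = v then edgeInd p q u w + edgeInd p q w v else
    if x = w then edgeInd p q u w else 0, fun x y hxy => ?_, by simp [huv, huw], by simp⟩
  simp only [IsEdgeOfPath, List.infix_cons_iff, List.infix_nil, List.cons_prefix_cons,
    List.prefix_nil, List.nil_prefix] at hxy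
  have := edgeInd_comm p q u w
  have := edgeInd_comm p q w v
  grind

variable {G : SimpleGraph V} {M : RotationSystem G} {F : M.Face} {s t h h' : List V}

theorem HomotopyMove.elementaryMove [Finite V] (hM : M.IsTriangulation)
    (hm : HomotopyMove M F s t h h') : ElementaryMove G h h' := by
  cases hm with
  | faceFlip F₁ x y z A B =>
    simpa using ElementaryMove.insert (G := G) (A ++ [x]) (y :: B) z (by simp)
  | faceFlipReverse F₁ x y z A B =>
    simpa using ElementaryMove.delete (G := G) (A ++ [x]) (y :: B) z (by simp)
  | edgeSlide F₁ F₂ x y a b A B _ _ _ h₁ =>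
    simpa using ElementaryMove.replace (A ++ [a]) (b :: B) x y (face_spec hM h₁).1
  | startMove x y B => exact ElementaryMove.insert [] (x :: B) y (by simp)
  | startMoveReverse x y B => exact ElementaryMove.delete [] (x :: B) y (by simp)
  | endMove x y A => simpa using ElementaryMove.insert (G := G) (A ++ [x]) [] y (by simp)
  | endMoveReverse x y A => simpa using ElementaryMove.delete (G := G) (A ++ [x]) [] y (by simp)
  | startEdgeSlide F₁ x y z B _ _ h₁ =>
    exact ElementaryMove.replace [] (z :: B) x y (face_spec hM h₁).1
  | endEdgeSlide F₁ x y z A _ _ h₁ =>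
    simpa using ElementaryMove.replace (A ++ [z]) [] x y (face_spec hM h₁).1

theorem exchanged_of_replace {P Q : List V} {x y : V} (hx : (P ++ x :: Q).Nodup)
    (hy : (P ++ y :: Q).Nodup) (hxy : x ≠ y) : Exchanged (P ++ x :: Q) (P ++ y :: Q) x y := by
  have hx' := List.nodup_middle.1 hx
  have hy' := List.nodup_middle.1 hy
  rw [List.nodup_cons, List.mem_append] at hx' hy'
  unfold Exchanged
  simp only [List.mem_append, List.mem_cons]
  grind

/-- The face `F₁` is inner and its boundary edges are shown by the curves `h` and `h'`. -/
def IsShown (F F₁ : M.Face) (h h' : List V) : Prop :=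
  F₁ ≠ F ∧ ∀ x ∈ M.faceVerts F₁, ∀ y ∈ M.faceVerts F₁, x ≠ y → Exposes h h' x y

theorem IsShown.of_triple {F₁ : M.Face} {x y z : V} (hne : F₁ ≠ F)
    (hF : M.faceVerts F₁ = {x, y, z}) (hxy : Exposes h h' x y) (hxz : Exposes h h' x z)
    (hyz : Exposes h h' y z) : IsShown F F₁ h h' := by
  refine ⟨hne, ?_⟩
  rw [hF]
  rintro a (rfl | rfl | rfl) b (rfl | rfl | rfl) hab <;>
    first
      | exact absurd rfl hab
      | assumption
      | exact Exposes.symm (by assumption)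

theorem IsShown.of_faceInd_ne_zero {F₁ : M.Face} (hs : IsShown F F₁ h h') :
    ∀ F₂, faceInd F₁ F₂ ≠ 0 → IsShown F F₂ h h' := by
  intro F₂ h2
  by_cases he : F₂ = F₁
  · exact he ▸ hs
  · simp [faceInd, he] at h2

/-- A move changes the closed chain of the curve by the boundaries of the faces it sweeps. -/
theorem HomotopyMove.exists_faces [Finite V] (hM : M.IsTriangulation)
    (hm : HomotopyMove M F s t h h') (hh : h.Nodup) (hh' : h'.Nodup) :
    ∃ n : M.Face → ZMod 2, (∀ F₁, n F₁ ≠ 0 → IsShown F F₁ h h') ∧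
      ∀ (d : G.Dart) (σ τ : V → ZMod 2), IsPotential d.fst d.snd s σ →
        IsPotential d.fst d.snd t τ →
        closedInd d.fst d.snd σ τ h' = closedInd d.fst d.snd σ τ h + dualDiff n d := by
  cases hm with
  | faceFlip F₁ x y z A B hne hF =>
    refine ⟨faceInd F₁, IsShown.of_faceInd_ne_zero (.of_triple hne hF ?_ ?_ ?_), fun d σ τ _ _ => ?_⟩
    · exact Or.inl (Or.inl ⟨A, B, rfl⟩)
    · exact Or.inr (Or.inl (Or.inl ⟨A, y :: B, by simp⟩))
    · exact Or.inr (Or.inl (Or.inr ⟨A ++ [x], B, by simp⟩))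
    · have := edgeInd_comm d.fst d.snd y z
      rw [(face_spec hM hF).2.2.2 d]
      simp only [closedInd, List.append_assoc, List.cons_append, List.nil_append,
        pathInd_append_cons_cons, pathInd_cons_cons, List.head?_append, List.getLast?_append,
        List.getLast?_cons_cons, List.head?_cons]
      grind
  | faceFlipReverse F₁ x y z A B hne hF =>
    refine ⟨faceInd F₁, IsShown.of_faceInd_ne_zero (.of_triple hne hF ?_ ?_ ?_), fun d σ τ _ _ => ?_⟩
    · exact Or.inr (Or.inl (Or.inl ⟨A, B, rfl⟩))
    · exact Or.inl (Or.inl ⟨A, y :: B, by simp⟩)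
    · exact Or.inl (Or.inr ⟨A ++ [x], B, by simp⟩)
    · have := edgeInd_comm d.fst d.snd y z
      rw [(face_spec hM hF).2.2.2 d]
      simp only [closedInd, List.append_assoc, List.cons_append, List.nil_append,
        pathInd_append_cons_cons, pathInd_cons_cons, List.head?_append, List.getLast?_append,
        List.getLast?_cons_cons, List.head?_cons]
      grind
  | edgeSlide F₁ F₂ x y a b A B hne₁ hne₂ _ hF₁ hF₂ =>
    have hex : Exchanged (A ++ [a, x, b] ++ B) (A ++ [a, y, b] ++ B) x y := by
      have := exchanged_of_replace (P := A ++ [a]) (Q := b :: B) (x := x) (y := y)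
        (by simpa using hh) (by simpa using hh') (face_spec hM hF₁).1.ne
      simpa using this
    have hs₁ : IsShown F F₁ (A ++ [a, x, b] ++ B) (A ++ [a, y, b] ++ B) :=
      .of_triple hne₁ hF₁ (Or.inr (Or.inr (Or.inl hex)))
        (Or.inl (Or.inr ⟨A, b :: B, by simp⟩)) (Or.inr (Or.inl (Or.inr ⟨A, b :: B, by simp⟩)))
    have hs₂ : IsShown F F₂ (A ++ [a, x, b] ++ B) (A ++ [a, y, b] ++ B) :=
      .of_triple hne₂ hF₂ (Or.inr (Or.inr (Or.inl hex)))
        (Or.inl (Or.inl ⟨A ++ [a], B, by simp⟩))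
        (Or.inr (Or.inl (Or.inl ⟨A ++ [a], B, by simp⟩)))
    -- The common edge `xy` cancels mod 2, leaving the two old and the two new curve edges.
    refine ⟨faceInd F₁ + faceInd F₂, fun F₃ h3 => ?_, fun d σ τ _ _ => ?_⟩
    · by_cases h31 : faceInd F₁ F₃ = 0
      · refine IsShown.of_faceInd_ne_zero hs₂ F₃ fun h32 => h3 ?_
        simp [h31, h32]
      · exact IsShown.of_faceInd_ne_zero hs₁ F₃ h31
    · have e₁ := (face_spec hM hF₁).2.2.2 d
      have e₂ := (face_spec hM hF₂).2.2.2 d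
      have := edgeInd_comm d.fst d.snd a x
      have := edgeInd_comm d.fst d.snd a y
      simp only [dualDiff, Pi.add_apply] at e₁ e₂ ⊢
      simp only [closedInd, List.append_assoc, List.cons_append, List.nil_append,
        pathInd_append_cons_cons, pathInd_cons_cons, List.head?_append, List.getLast?_append,
        List.getLast?_cons_cons, List.head?_cons]
      grind
  | startMove x y B hs =>
    -- No face is swept: the new curve edge is cancelled by the change of the potential.
    refine ⟨0, fun _ h => absurd rfl h, fun d σ τ hσ _ => ?_⟩
    have := hσ x y hs
    simp only [closedInd, dualDiff, Pi.zero_apply, pathInd_cons_cons, List.head?_cons,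
      List.getLast?_cons_cons, Option.elim_some]
    have := edgeInd_comm d.fst d.snd x y
    grind
  | startMoveReverse x y B hs =>
    refine ⟨0, fun _ h => absurd rfl h, fun d σ τ hσ _ => ?_⟩
    have := hσ x y hs
    simp only [closedInd, dualDiff, Pi.zero_apply, pathInd_cons_cons, List.head?_cons,
      List.getLast?_cons_cons, Option.elim_some]
    have := edgeInd_comm d.fst d.snd x y
    grind
  | endMove x y A ht =>
    refine ⟨0, fun _ h => absurd rfl h, fun d σ τ _ hτ => ?_⟩
    have := hτ x y ht
    simp only [closedInd, dualDiff, Pi.zero_apply, pathInd_append_cons_cons,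
      pathInd_singleton, List.head?_append, List.head?_cons,
      List.getLast?_append, List.getLast?_cons_cons, List.getLast?_singleton, Option.some_or,
      Option.elim_some]
    grind
  | endMoveReverse x y A ht =>
    refine ⟨0, fun _ h => absurd rfl h, fun d σ τ _ hτ => ?_⟩
    have := hτ x y ht
    simp only [closedInd, dualDiff, Pi.zero_apply, pathInd_append_cons_cons,
      pathInd_singleton, List.head?_append, List.head?_cons,
      List.getLast?_append, List.getLast?_cons_cons, List.getLast?_singleton, Option.some_or,
      Option.elim_some]
    grind
  | startEdgeSlide F₁ x y z B hs hne hF =>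
    have hex : Exchanged (x :: z :: B) (y :: z :: B) x y :=
      exchanged_of_replace (P := []) hh hh' (face_spec hM hF).1.ne
    refine ⟨faceInd F₁, IsShown.of_faceInd_ne_zero (.of_triple hne hF (Or.inr (Or.inr (Or.inl hex)))
      (Or.inl (Or.inl ⟨[], B, rfl⟩)) (Or.inr (Or.inl (Or.inl ⟨[], B, rfl⟩)))),
      fun d σ τ hσ _ => ?_⟩
    -- The boundary edge `xy` of the swept face enters through the change of `σ`, not through the
    -- curve.
    have := hσ x y hs
    rw [(face_spec hM hF).2.2.2 d]
    simp only [closedInd, pathInd_cons_cons, List.head?_cons,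
      List.getLast?_cons_cons, Option.elim_some]
    grind
  | endEdgeSlide F₁ x y z A ht hne hF =>
    have hex : Exchanged (A ++ [z, x]) (A ++ [z, y]) x y := by
      have := exchanged_of_replace (P := A ++ [z]) (Q := []) (x := x) (y := y)
        (by simpa using hh) (by simpa using hh') (face_spec hM hF).1.ne
      simpa using this
    refine ⟨faceInd F₁, IsShown.of_faceInd_ne_zero (.of_triple hne hF (Or.inr (Or.inr (Or.inl hex)))
      (Or.inl (Or.inr ⟨A, [], by simp⟩)) (Or.inr (Or.inl (Or.inr ⟨A, [], by simp⟩)))),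
      fun d σ τ _ hτ => ?_⟩
    have := hτ x y ht
    have := edgeInd_comm d.fst d.snd x z
    have := edgeInd_comm d.fst d.snd y z
    rw [(face_spec hM hF).2.2.2 d]
    simp only [closedInd, pathInd_append_cons_cons,
      pathInd_singleton, List.head?_append, List.head?_cons,
      List.getLast?_append, List.getLast?_cons_cons, List.getLast?_singleton, Option.some_or,
      Option.elim_some]
    grind

/-! ### Every inner face is swept and every edge is exposed -/

/-- The curve with index `i` of a homotopy; constant from the last index on. -/
def SimpleHomotopy.curveAt (H : SimpleHomotopy M F) (i : ℕ) : List V :=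
  H.curve ⟨min i H.W, by omega⟩

namespace SimpleHomotopy

variable (H : SimpleHomotopy M F)

theorem move_curveAt {i : ℕ} (hi : i < H.W) :
    HomotopyMove M F H.s H.t (H.curveAt i) (H.curveAt (i + 1)) := by
  have := H.move ⟨i, hi⟩
  unfold curveAt
  convert this using 2
  · ext; simp; omega
  · ext; simp; omega

/-- Sum the face functions of the first `j` moves; where the sum is nonzero, some move has swept the
face. -/
theorem exists_faces [Finite V] (hM : M.IsTriangulation) (j : ℕ) (hj : j ≤ H.W) :
    ∃ n : M.Face → ZMod 2,
      (∀ F₁, n F₁ ≠ 0 → ∃ i < H.W, IsShown F F₁ (H.curveAt i) (H.curveAt (i + 1))) ∧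
      ∀ (d : G.Dart) (σ τ : V → ZMod 2), IsPotential d.fst d.snd H.s σ →
        IsPotential d.fst d.snd H.t τ →
        closedInd d.fst d.snd σ τ (H.curveAt j) =
          closedInd d.fst d.snd σ τ (H.curveAt 0) + dualDiff n d := by
  induction j with
  | zero => exact ⟨0, fun _ h => absurd rfl h, fun d σ τ _ _ => by simp [dualDiff]⟩
  | succ j ih =>
    obtain ⟨n, hn, hψ⟩ := ih (by omega)
    obtain ⟨n', hn', hψ'⟩ := (H.move_curveAt hj).exists_faces hM (H.simple _) (H.simple _)
    refine ⟨n + n', fun F₁ hF₁ => ?_, fun d σ τ hσ hτ => ?_⟩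
    · by_cases h0 : n F₁ = 0
      · exact ⟨j, hj, hn' F₁ fun h0' => hF₁ (by simp [h0, h0'])⟩
      · exact hn F₁ h0
    · rw [hψ' d σ τ hσ hτ, hψ d σ τ hσ hτ]
      simp only [dualDiff, Pi.add_apply]
      ring

/-- Normalized at `u`, the potentials at `v` count the dart's edge on `s` and on `t`, which together
form the outer boundary. So the closed chain vanishes at `[u]` and is that boundary at `[v]`. -/
theorem exists_potentials [Finite V] (hM : M.IsTriangulation) (d : G.Dart) :
    ∃ σ τ, IsPotential d.fst d.snd H.s σ ∧ IsPotential d.fst d.snd H.t τ ∧ σ H.u = 0 ∧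
      τ H.u = 0 ∧ σ H.v + τ H.v = dualDiff (faceInd F) d := by
  obtain ⟨huv, huw, hvw, hd⟩ := face_spec hM H.outer
  obtain ⟨σ, hσ, hσu, hσv⟩ := exists_potential_of_pair d.fst d.snd H.u H.v H.u_ne_v
  obtain ⟨τ, hτ, hτu, hτv⟩ :=
    exists_potential_of_triple d.fst d.snd H.u H.w H.v huv.ne huw.ne hvw.ne.symm
  have hsum : σ H.v + τ H.v = dualDiff (faceInd F) d := by
    rw [hσv, hτv, hd, edgeInd_comm _ _ H.w H.v, add_assoc]
  rcases H.subpaths with ⟨hs, ht⟩ | ⟨hs, ht⟩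
  · exact ⟨σ, τ, hs ▸ hσ, ht ▸ hτ, hσu, hτu, hsum⟩
  · exact ⟨τ, σ, hs ▸ hτ, ht ▸ hσ, hτu, hσu, (add_comm _ _).trans hsum⟩

/-- Every inner face is swept. -/
theorem exists_isShown [Finite V] (hM : M.IsTriangulation) (F₁ : M.Face) (hF₁ : F₁ ≠ F) :
    ∃ i < H.W, IsShown F F₁ (H.curveAt i) (H.curveAt (i + 1)) := by
  obtain ⟨n, hn, hψ⟩ := H.exists_faces hM H.W le_rfl
  have h0 : H.curveAt 0 = [H.u] := by
    rw [← H.first]; unfold curveAt; congr 1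
  have hW : H.curveAt H.W = [H.v] := by
    rw [← H.last]; unfold curveAt; congr 1; ext; exact Nat.min_self _
  have hnF : n F = 0 := by
    -- Moves sweep only inner faces.
    by_contra h
    obtain ⟨_, _, h⟩ := hn F h
    exact h.1 rfl
  have hzero : ∀ d, dualDiff (n + faceInd F) d = 0 := fun d => by
    obtain ⟨σ, τ, hσ, hτ, hσu, hτu, hsum⟩ := H.exists_potentials hM d
    have := hψ d σ τ hσ hτ
    rw [h0, hW] at this
    simp only [closedInd, pathInd_singleton, List.head?_cons, List.getLast?_singleton,
      Option.elim_some, hσu, hτu] at this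
    simp only [dualDiff, Pi.add_apply] at hsum this ⊢
    grind
  obtain ⟨d, rfl⟩ := Quotient.exists_rep F
  obtain ⟨d₁, rfl⟩ := Quotient.exists_rep F₁
  -- `n + faceInd F` is constant, with value `0 + 1` at the outer face, whereas `n F₁ = 0` would
  -- give `0` at `F₁`.
  have heq := eq_of_dualDiff_eq_zero hM.1.1 hzero d₁ d
  refine hn _ fun h => ?_
  simp only [Pi.add_apply] at heq
  change n (M.faceOf d₁) = 0 at h
  change n (M.faceOf d) = 0 at hnF
  rw [h, hnF] at heq
  change M.faceOf d₁ ≠ M.faceOf d at hF₁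
  change 0 + faceInd (M.faceOf d) (M.faceOf d₁) = 0 + faceInd (M.faceOf d) (M.faceOf d) at heq
  simp [faceInd, hF₁] at heq

theorem exists_exposes [Finite V] (hM : M.IsTriangulation) (a b : V) (hab : G.Adj a b) :
    ∃ i < H.W, Exposes (H.curveAt i) (H.curveAt (i + 1)) a b := by
  have key : ∀ a b (hab : G.Adj a b), M.faceOf ⟨(a, b), hab⟩ ≠ F →
      ∃ i < H.W, Exposes (H.curveAt i) (H.curveAt (i + 1)) a b := fun a b hab hne => by
    obtain ⟨i, hi, h⟩ := H.exists_isShown hM _ hne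
    exact ⟨i, hi, h.2 a ⟨_, rfl, rfl⟩ b ⟨_, faceOf_facePerm _, facePerm_fst _⟩ hab.ne⟩
  by_cases hF : M.faceOf ⟨(a, b), hab⟩ = F
  · obtain ⟨i, hi, h⟩ := key b a hab.symm
      -- If one side of the edge is the outer face, the other side is inner.
      fun h => faceOf_ne_faceOf_symm hM ⟨(a, b), hab⟩ (hF.trans h.symm)
    exact ⟨i, hi, h.symm⟩
  · exact key a b hab hF

theorem exists_contact_gridRep [Finite V] (hM : M.IsTriangulation) :
    ∃ (N : ℕ) (R : GridRep G N H.height), R.IsSimple ∧ R.IsContact := by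
  have : Nontrivial V := ⟨H.u, H.v, H.u_ne_v⟩
  refine exists_gridRep (W := H.W) (g := H.curveAt) (fun i _ => H.walk _) (fun i _ => H.simple _)
    (fun i _ h => ?_) (fun i _ => ?_) (fun i hi => (H.move_curveAt hi).elementaryMove hM)
    (fun i j l hij hjl _ a => H.consecutive _ _ _ ?_ ?_ a) (H.exists_exposes hM)
    hM.1.1.preconnected.exists_adj_of_nontrivial
  · obtain ⟨a, _, ha⟩ := H.starts_on ⟨min i H.W, by omega⟩
    change (H.curveAt i).head? = some a at ha
    simp [h] at ha
  · exact Finset.le_sup (f := fun i => (H.curve i).length) (Finset.mem_univ _)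
  · exact Fin.le_def.2 (min_le_min_right _ hij)
  · exact Fin.le_def.2 (min_le_min_right _ hjl)

end SimpleHomotopy

end Coverage

theorem lemma1 {V : Type*} [Finite V] (G : SimpleGraph V) (hG : G.IsTriangulatedPlanar) :
    G.sGMh ≤ G.sHh ∧
      ∀ M : RotationSystem G, M.IsTriangulation → ∀ (F : M.Face) (h : SimpleHomotopy M F),
        ∃ (W : ℕ) (R : GridRep G W h.height), R.IsSimple ∧ R.IsContact := by
  have key : ∀ M : RotationSystem G, M.IsTriangulation → ∀ (F : M.Face) (h : SimpleHomotopy M F),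
      ∃ (W : ℕ) (R : GridRep G W h.height), R.IsSimple ∧ R.IsContact :=
    fun M hM F h => h.exists_contact_gridRep hM
  refine ⟨?_, key⟩
  refine le_iInf fun M => le_iInf fun hM => le_iInf fun F => le_iInf fun h => ?_
  obtain ⟨W, R, hR, -⟩ := key M hM F h
  exact iInf_le_of_le h.height (iInf_le_of_le W (iInf_le_of_le R (iInf_le_of_le hR le_rfl)))
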